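/- **Setting.** The Congested Clique on $n\ge 2$ nodes with IDs $0,\dots,n-1$ is the synchronous model in which, in every round, each node may send to each other node one (possibly different) message of $O(\log n)$ bits; local computation is free, and the message complexity is the total number of messages sent. Let $G=(V,E,w)$ be an $n$-node graph with distinct non-negative integer edge weights, each of $O(\log n)$ bits, let $F\subseteq G$ be a forest, and let $p\in(0,1]$. Run Borůvka's algorithm on $F$: $\mathcal C^i=\{C^i_1,C^i_2,\dots\}$ are the components at the beginning of phase $i$ ($\mathcal C^0$ consists of singletons), $e^i_j$ is the minimum weight edge of $F$ leaving $C^i_j$ (with $w(e^i_j)=\infty$ if there is none), and the next components arise by merging along all $e^i_j$; the phases are $i=0,\dots,\lceil\log_2 n\rceil$. The leader of $C^i_j$ is its node of smallest ID. Let $L^i_j$ be the set of edges of $G$ with exactly one endpoint in $C^i_j$ and weight at most $w(e^i_j)$. For a node $v\in C^i_j$ let $\mathbf a^i_v$ be the signed edge-incidence vector of $v$ in $G$ restricted to edges of weight at most $w(e^i_j)$ (entry $+1$ if $v$ is the smaller endpoint, $-1$ if it is the larger one), so that $\sum_{v\in C^i_j}\mathbf a^i_v$ has support $L^i_j$. For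 every phase, $\beta=O(\log^5 n/p)$ linear sketches are given, depending on a shared random seed: the $k$-th sketch of a vector is its image under an additive map into a finite abelian group whose elements have $O(\log^4 n)$ bits, together with a procedure that tries to read off a nonzero entry of a vector from its sketch. (The result holds for every value of the seed and whatever the accuracy of this procedure.) The $k$-th sketch of $C^i_j$ is the sum of the $k$-th sketches of $\mathbf a^i_v$ over $v\in C^i_j$. An edge is *sampled* if it is returned by the procedure on some sketch of some $C^i_j$ and lies in $L^i_j$ (otherwise the sampling from that sketch has failed). **Step 5 of Compute-F-Light** is the following task. Initially each node $v$ knows the seed, its incident edges in $G$ and in $F$ with their weights, and, for every phase $i$, the leader of its component $C^i_j$, the weight $w(e^i_j)$ and its own $\beta$ sketches of $\mathbf a^i_v$; moreover $\lceil\log_2 n\rceil+1$ fixed commander nodes know the whole weighted forest $F$. At the end, for all $i$ and $j$, the leader of $C^i_j$ must hold all $\beta$ sketches of $C^i_j$, and every node must know exactly which of its incident edges have been sampled, over all $i$ and $j$. **Lemma.** For every constant $\gamma<1$ and all $p$ with $n^{-\gamma}\le p\le 1$ (in particular for $p=\sqrt{n/m}$ where $m=|E|\ge n$, taking $\gamma=1/2$),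 Step 5 of Compute-F-Light can be implemented in the Congested Clique in $O(1)$ rounds using $\widetilde O(n/p)=O\big((n/p)\cdot\mathrm{poly}(\log n)\big)$ messages. The implied constants, including the one in the message size and the exponent of the polylogarithm, depend only on $\gamma$ and on the constants implied in the bounds on $\beta$, the sketch size and the weights. -/

import Mathlib

/-! ### The Congested Clique -/

/-- A synchronous message-passing algorithm on the clique with node set `Fin n` (a node is
identified with its ID, and all IDs are known to everybody).  `I` is the type of the local inputs
and `O` the type of the local outputs.  Local computation is unrestricted.  In round `t` a node `u`
may send to each node `v` one message from an alphabet with `n ^ b` letters, that is, of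
`b * log₂ n` bits; `none` means that nothing is sent. -/
structure CliqueProtocol (n b : ℕ) (I O : Type) where
  State : Type
  init : Fin n → I → State
  send : ℕ → (u : Fin n) → State → (v : Fin n) → Option (Fin (n ^ b))
  receive : ℕ → (v : Fin n) → State → ((u : Fin n) → Option (Fin (n ^ b))) → State
  output : Fin n → State → O

namespace CliqueProtocol

variable {n b : ℕ} {I O : Type} (P : CliqueProtocol n b I O)

/-- The message that travels from `u` to `v` in round `t` when the current states are `σ`.
There is no link from a node to itself. -/
def delivered (t : ℕ) (σ : Fin n → P.State) (u v : Fin n) : Option (Fin (n ^ b)) :=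
  if u = v then none else P.send t u (σ u) v

/-- The states of all nodes after `t` rounds on the local inputs `x`. -/
def stateAfter (x : Fin n → I) : ℕ → Fin n → P.State
  | 0 => fun v => P.init v (x v)
  | t + 1 => fun v =>
      P.receive t v (stateAfter x t v) (fun u => P.delivered t (stateAfter x t) u v)

/-- The local output of node `v` after `R` rounds on the local inputs `x`. -/
def result (x : Fin n → I) (R : ℕ) (v : Fin n) : O :=
  P.output v (P.stateAfter x R v)

/-- The total number of messages sent during the first `R` rounds on the local inputs `x`. -/
def messageCount (x : Fin n → I) (R : ℕ) : ℕ :=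
  ∑ t ∈ Finset.range R, ∑ u : Fin n, ∑ v : Fin n,
    if (P.delivered t (P.stateAfter x t) u v).isSome then 1 else 0

end CliqueProtocol

/-! ### Borůvka's algorithm on a forest -/

section Boruvka

variable {V : Type}

/-- The edges of `K` with exactly one endpoint in `S`. -/
def cutEdges (K : SimpleGraph V) (S : Set V) : Set (Sym2 V) :=
  {e | e ∈ K.edgeSet ∧ ∃ u ∈ S, ∃ v ∉ S, e = s(u, v)}

/-- `e` is a minimum weight edge of `F` that leaves `S`. -/
def IsMWOE (F : SimpleGraph V) (w : Sym2 V → ℕ) (S : Set V) (e : Sym2 V) : Prop :=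
  e ∈ cutEdges F S ∧ ∀ e' ∈ cutEdges F S, w e ≤ w e'

/-- The edges of `F` that Borůvka's algorithm on `F` has selected before phase `i`, for
`i = 0, 1, 2, …`: in each phase every current component selects its minimum weight outgoing edge
in `F`, if there is one. -/
def boruvka (F : SimpleGraph V) (w : Sym2 V → ℕ) : ℕ → SimpleGraph V
  | 0 => ⊥
  | i + 1 => boruvka F w i ⊔ SimpleGraph.fromEdgeSet
      {e | ∃ v : V, IsMWOE F w {u | (boruvka F w i).Reachable v u} e}

open Classical in
/-- The component of `v` at the beginning of phase `i`. -/
noncomputable def phaseComp [Fintype V] (F : SimpleGraph V) (w : Sym2 V → ℕ) (i : ℕ) (v : V) :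
    Finset V :=
  Finset.univ.filter fun u => (boruvka F w i).Reachable v u

/-- The weight of the minimum weight outgoing edge in `F` of the phase-`i` component of `v`;
it is `⊤` if no edge of `F` leaves that component. -/
noncomputable def phaseWeight [Fintype V] (F : SimpleGraph V) (w : Sym2 V → ℕ) (i : ℕ) (v : V) :
    ℕ∞ :=
  ⨅ e ∈ cutEdges F (phaseComp F w i v : Set V), (w e : ℕ∞)

/-- The edges of `G` that leave the phase-`i` component of `v` and weigh at most as much as its
minimum weight outgoing edge in `F`. -/
def lightCut [Fintype V] (G F : SimpleGraph V) (w : Sym2 V → ℕ) (i : ℕ) (v : V) :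
    Set (Sym2 V) :=
  {e | e ∈ cutEdges G (phaseComp F w i v : Set V) ∧ (w e : ℕ∞) ≤ phaseWeight F w i v}

theorem mem_phaseComp_self [Fintype V] (F : SimpleGraph V) (w : Sym2 V → ℕ) (i : ℕ) (v : V) :
    v ∈ phaseComp F w i v := by
  simp [phaseComp]

/-- The leader (node of smallest ID) of the phase-`i` component of `v`. -/
noncomputable def phaseLeader [Fintype V] [LinearOrder V] (F : SimpleGraph V) (w : Sym2 V → ℕ)
    (i : ℕ) (v : V) : V :=
  (phaseComp F w i v).min' ⟨v, mem_phaseComp_self F w i v⟩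

end Boruvka

/-- The number of phases: a component before phase `i` has at least `2 ^ i` nodes unless it is
already a component of `F`, so in phase `⌈log₂ n⌉` (counted from `0`) all components are components
of `F`.  This is also the number of commanders. -/
def numPhases (n : ℕ) : ℕ := Nat.clog 2 n + 1

/-! ### Linear sketches -/

open Classical in
/-- The signed incidence vector of `v` restricted to the edges of weight at most `x`: its nonzero
entries are the edges of `G` of weight at most `x` at `v`, with sign `1` at the smaller
endpoint and `-1` at the larger one. -/
noncomputable def incidenceVector {n : ℕ} (G : SimpleGraph (Fin n)) (w : Sym2 (Fin n) → ℕ)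
    (x : ℕ∞) (v : Fin n) : Sym2 (Fin n) → ℤ := fun e =>
  if e ∈ G.edgeSet ∧ v ∈ e ∧ (w e : ℕ∞) ≤ x then (if v = e.inf then 1 else -1) else 0

/-- A scheme of linear sketches for edge vectors on `n` nodes, with `β` sketches in every phase.
The sketches take values in an abelian group `A` (such as `(ℤ / q) ^ d` with coordinatewise
addition), they depend on a seed shared by all nodes, and they are linear.  `sample` is the
procedure that attempts to read off a nonzero entry of a vector from the sketch of the vector.  No
accuracy of it is demanded, so `ℓ₀`-samplers are a special case. -/
structure SketchScheme (n β : ℕ) (Seed A : Type) [AddCommGroup A] where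
  sketch : Seed → Fin (numPhases n) → Fin β → (Sym2 (Fin n) → ℤ) →+ A
  sample : Seed → Fin (numPhases n) → Fin β → A → Option (Sym2 (Fin n))

namespace SketchScheme

variable {n β : ℕ} {Seed A : Type} [AddCommGroup A] (S : SketchScheme n β Seed A)

/-- The `k`-th sketch that node `v` computes for its component in phase `i`. -/
noncomputable def nodeSketch (r : Seed) (G F : SimpleGraph (Fin n)) (w : Sym2 (Fin n) → ℕ)
    (i : Fin (numPhases n)) (k : Fin β) (v : Fin n) : A :=
  S.sketch r i k (incidenceVector G w (phaseWeight F w i v) v)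

/-- The `k`-th sketch of the phase-`i` component of `v`: the sum of the sketches of its nodes. -/
noncomputable def componentSketch (r : Seed) (G F : SimpleGraph (Fin n)) (w : Sym2 (Fin n) → ℕ)
    (i : Fin (numPhases n)) (k : Fin β) (v : Fin n) : A :=
  ∑ u ∈ phaseComp F w i v, S.nodeSketch r G F w i k u

/-- The edges sampled from all component sketches, over all phases and all components.  A sampling
is successful if it returns a nonzero entry of the sketched vector, that is, an edge in the
`lightCut` of the component; otherwise it fails and yields no edge. -/
def sampledEdges (r : Seed) (G F : SimpleGraph (Fin n)) (w : Sym2 (Fin n) → ℕ) :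
    Set (Sym2 (Fin n)) :=
  {e | ∃ (i : Fin (numPhases n)) (v : Fin n) (k : Fin β),
    S.sample r i k (S.componentSketch r G F w i k v) = some e ∧ e ∈ lightCut G F w i v}

end SketchScheme

/-! ### The gathering and sampling step -/

/-- What a node knows before the step. -/
structure LocalView (n β : ℕ) (Seed A : Type) where
  /-- the shared random seed of the sketches -/
  seed : Seed
  /-- the weight of the edge of `G` to each node, if there is such an edge -/
  incidentG : Fin n → Option ℕ
  /-- the weight of the edge of `F` to each node, if there is such an edge -/
  incidentF : Fin n → Option ℕ
  /-- for each phase, the leader of the own component -/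
  label : Fin (numPhases n) → Fin n
  /-- for each phase, the weight of the minimum weight outgoing edge of the own component -/
  weight : Fin (numPhases n) → ℕ∞
  /-- the own sketches for each phase -/
  sketches : Fin (numPhases n) → Fin β → A
  /-- for commanders only: the whole weighted forest `F` -/
  forest : Option (Sym2 (Fin n) → Option ℕ)

open Classical in
/-- The knowledge of node `v` before the step.  The commanders are the first `numPhases n` nodes. -/
noncomputable def localView {n β : ℕ} {Seed A : Type} [AddCommGroup A]
    (S : SketchScheme n β Seed A) (r : Seed) (G F : SimpleGraph (Fin n))
    (w : Sym2 (Fin n) → ℕ) (v : Fin n) : LocalView n β Seed A where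
  seed := r
  incidentG u := if G.Adj v u then some (w s(v, u)) else none
  incidentF u := if F.Adj v u then some (w s(v, u)) else none
  label i := phaseLeader F w i v
  weight i := phaseWeight F w i v
  sketches i k := S.nodeSketch r G F w i k v
  forest := if v.val < numPhases n then
      some fun e => if e ∈ F.edgeSet then some (w e) else none
    else none

/-- What a node outputs at the end of the step: component sketches (meaningful for component
leaders) and the set of incident edges it has been notified about. -/
structure StepOutput (n β : ℕ) (A : Type) where
  compSketches : Fin (numPhases n) → Fin β → A
  notified : Set (Sym2 (Fin n))

/-- The local outputs `out` are those required of the step: for every phase, the leader of every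
component holds all `β` sketches of the component, and every node knows exactly which of its
incident edges have been sampled from some component sketch in some phase. -/
def StepCorrect {n β : ℕ} {Seed A : Type} [AddCommGroup A]
    (S : SketchScheme n β Seed A) (r : Seed) (G F : SimpleGraph (Fin n))
    (w : Sym2 (Fin n) → ℕ) (out : Fin n → StepOutput n β A) : Prop :=
  (∀ (i : Fin (numPhases n)) (v : Fin n) (k : Fin β),
    (out (phaseLeader F w i v)).compSketches i k = S.componentSketch r G F w i k v) ∧
  (∀ v : Fin n, (out v).notified = {e | e ∈ S.sampledEdges r G F w ∧ v ∈ e})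

/-!
Summing values of `T` messages each at a label, for all labels at once, would congest the label if
every node addressed it directly.  The nodes are therefore divided into `T` groups; a helper per
index and group adds up the values that share a label inside its group, so that a label receives
only one value per index and group.  Every value travels in `T` chunks through `T` parallel relays,
and packets that share relays are arranged by a fixed schedule, a cyclic shift, not to share a
source or a destination.  The relays suffice as long as (number of indices) * `T ^ 2` is `O(n)`,
which is what the lower bound `n ^ (-γ) ≤ p` provides; a constant number of virtual nodes per node
absorbs the constant.  With the labels being component leaders, the leaders obtain the component
sketches.  In one more round they learn the members of their components, so that they can orient
each edge read off a sketch to leave the component and send it to its inner endpoint, which checks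
the weight and notifies the outer endpoint.
-/

namespace CliqueProtocol

variable {n b : ℕ} {I J O : Type}

/-- The state of the second of two protocols run one after the other: it starts on the output of
the first. -/
def resume (P : CliqueProtocol n b I J) (Q : CliqueProtocol n b J O) (v : Fin n) :
    P.State ⊕ Q.State → Q.State :=
  Sum.elim (fun σ => Q.init v (P.output v σ)) id

/-- Sequential composition: run `P` for `R` rounds and feed its outputs to `Q`. -/
def seqComp (P : CliqueProtocol n b I J) (R : ℕ) (Q : CliqueProtocol n b J O) :
    CliqueProtocol n b I O where
  State := P.State ⊕ Q.State
  init v i := Sum.inl (P.init v i)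
  send t u s v :=
    if t < R then s.elim (fun σ => P.send t u σ v) (fun _ => none)
    else Q.send (t - R) u (resume P Q u s) v
  receive t v s m :=
    if t < R then s.elim (fun σ => Sum.inl (P.receive t v σ m)) Sum.inr
    else Sum.inr (Q.receive (t - R) v (resume P Q v s) m)
  output v s := Q.output v (resume P Q v s)

section SeqComp

variable (P : CliqueProtocol n b I J) (R : ℕ) (Q : CliqueProtocol n b J O) (x : Fin n → I)

theorem seqComp_delivered_of_inl {t : ℕ} (ht : t < R) (σ : Fin n → P.State) :
    (P.seqComp R Q).delivered t (fun v => Sum.inl (σ v)) = P.delivered t σ := by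
  simp [delivered, seqComp, ht, funext_iff]

theorem seqComp_stateAfter_of_le {t : ℕ} (ht : t ≤ R) :
    (P.seqComp R Q).stateAfter x t = fun v => Sum.inl (P.stateAfter x t v) := by
  induction t with
  | zero => rfl
  | succ t ih =>
    funext v
    rw [stateAfter, ih (Nat.le_of_succ_le ht), seqComp_delivered_of_inl P R Q ht]
    simp [seqComp, stateAfter, Nat.lt_of_succ_le ht]

theorem seqComp_delivered_add (t : ℕ) (σ : Fin n → (P.seqComp R Q).State) :
    (P.seqComp R Q).delivered (R + t) σ = Q.delivered t (fun v => resume P Q v (σ v)) := by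
  simp [delivered, seqComp, funext_iff]

theorem resume_seqComp_stateAfter_add (t : ℕ) (v : Fin n) :
    resume P Q v ((P.seqComp R Q).stateAfter x (R + t) v) =
      Q.stateAfter (P.result x R) t v := by
  induction t generalizing v with
  | zero =>
    rw [Nat.add_zero, seqComp_stateAfter_of_le P R Q x le_rfl]
    rfl
  | succ t ih =>
    have hd : (P.seqComp R Q).delivered (R + t) ((P.seqComp R Q).stateAfter x (R + t)) =
        Q.delivered t (Q.stateAfter (P.result x R) t) := by
      rw [seqComp_delivered_add, ← funext ih]
    calc resume P Q v ((P.seqComp R Q).stateAfter x (R + t + 1) v)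
        = Q.receive t v (resume P Q v ((P.seqComp R Q).stateAfter x (R + t) v))
            (fun u => (P.seqComp R Q).delivered (R + t)
              ((P.seqComp R Q).stateAfter x (R + t)) u v) := by
          simp [stateAfter, seqComp, resume]
      _ = Q.stateAfter (P.result x R) (t + 1) v := by rw [ih, hd, stateAfter]

theorem seqComp_result (R' : ℕ) :
    (P.seqComp R Q).result x (R + R') = Q.result (P.result x R) R' :=
  funext fun v => congrArg (Q.output v) (resume_seqComp_stateAfter_add P R Q x R' v)

theorem seqComp_messageCount (R' : ℕ) :
    (P.seqComp R Q).messageCount x (R + R') =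
      P.messageCount x R + Q.messageCount (P.result x R) R' := by
  unfold messageCount
  rw [Finset.sum_range_add]
  congr 1
  · refine Finset.sum_congr rfl fun t ht => ?_
    have ht := Finset.mem_range.1 ht
    rw [seqComp_stateAfter_of_le P R Q x ht.le, seqComp_delivered_of_inl P R Q ht]
  · refine Finset.sum_congr rfl fun t _ => ?_
    simp only [seqComp_delivered_add, resume_seqComp_stateAfter_add]

end SeqComp

end CliqueProtocol

section Messages

variable {α δ ι U C X Y : Type}

/-- The number of messages in a round in which `a` sends `m a c` to `c`. -/
def numMessages [Fintype α] [Fintype δ] (m : α → δ → Option X) : ℕ :=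
  Finset.card {q : α × δ | (m q.1 q.2).isSome}

theorem numMessages_eq_sum [Fintype α] [Fintype δ] (m : α → δ → Option X) :
    numMessages m = ∑ a, ∑ c, if (m a c).isSome then 1 else 0 := by
  rw [numMessages, Finset.card_filter, Fintype.sum_prod_type]

theorem numMessages_le_card [Fintype α] [Fintype δ] [Fintype ι] {m : α → δ → Option X}
    (f : ι → α × δ) (hf : ∀ a c, (m a c).isSome → ∃ i, f i = (a, c)) :
    numMessages m ≤ Fintype.card ι :=
  Finset.card_le_card_of_surjOn f fun q hq => by simpa using hf q.1 q.2 (by simpa using hq)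

open Classical in
/-- The joint message to `v` of a node with virtual nodes numbered by `C`, the `j`-th of which sends
`m j (v, k)` to the `k`-th virtual node of `v`. -/
noncomputable def bundle (m : C → U × C → Option Y) (v : U) : Option (C → C → Option Y) :=
  if ∃ j k, (m j (v, k)).isSome then some fun j k => m j (v, k) else none

theorem bundle_bind (m : C → U × C → Option Y) (j : C) (c : U × C) :
    ((bundle m c.1).bind fun g => g j c.2) = m j c := by
  unfold bundle
  split_ifs with h
  · rfl
  · exact (Option.not_isSome_iff_eq_none.1 fun hm => h ⟨j, c.2, hm⟩).symm

theorem numMessages_bundle_le [Fintype U] [Fintype C] (m : U × C → U × C → Option Y) :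
    numMessages (fun u => bundle fun j => m (u, j)) ≤ numMessages m := by
  refine Finset.card_le_card_of_surjOn (fun q => (q.1.1, q.2.1)) ?_
  rintro ⟨u, v⟩ h
  obtain ⟨j, k, hjk⟩ : ∃ j k, (m (u, j) (v, k)).isSome := by
    by_contra hm
    simp [bundle, hm] at h
  exact ⟨((u, j), (v, k)), by simpa using hjk, rfl⟩

end Messages

namespace CliqueProtocol

variable {n b : ℕ} {I X : Type}

open Classical in
/-- The protocol of a single round in which `u` with input `i` sends `f u i v`, encoded by `e`, to
`v`.  As there is no link from a node to itself, `v` computes its own message `f v i v`. -/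
noncomputable def oneRound (f : Fin n → I → Fin n → Option X) (e : X ↪ Fin (n ^ b)) :
    CliqueProtocol n b I (I × (Fin n → Option X)) where
  State := I × (Fin n → Option X)
  init _ i := (i, fun _ => none)
  send _ u s v := (f u s.1 v).map e
  receive _ v s c :=
    (s.1, fun u => if u = v then f v s.1 v else (c u).bind (Function.partialInv e))
  output _ s := s

variable (f : Fin n → I → Fin n → Option X) (e : X ↪ Fin (n ^ b)) (x : Fin n → I)

theorem oneRound_result (v : Fin n) :
    (oneRound f e).result x 1 v = (x v, fun u => f u (x u) v) := by
  refine Prod.ext rfl (funext fun u => ?_)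
  rcases eq_or_ne u v with rfl | huv
  · simp [result, stateAfter, oneRound]
  · cases h : f u (x u) v <;>
      simp [result, stateAfter, oneRound, delivered, huv, h, Function.partialInv_left e.injective]

theorem oneRound_messageCount_le :
    (oneRound f e).messageCount x 1 ≤ numMessages fun u v => f u (x u) v := by
  rw [numMessages_eq_sum, messageCount, Finset.sum_range_one]
  refine Finset.sum_le_sum fun u _ => Finset.sum_le_sum fun v _ => ?_
  by_cases huv : u = v <;> simp [delivered, stateAfter, oneRound, huv]

end CliqueProtocol

/-- `Realizes b R N x y`: some protocol with messages from `n ^ b` letters turns the local inputs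
`x θ` into the local outputs `y θ` within `R` rounds and with at most `N` messages, for every
value of the global parameter `θ`. -/
def Realizes {n : ℕ} {Θ I O : Type} (b R N : ℕ) (x : Θ → Fin n → I) (y : Θ → Fin n → O) : Prop :=
  ∃ P : CliqueProtocol n b I O, ∀ θ, P.result (x θ) R = y θ ∧ P.messageCount (x θ) R ≤ N

/-- Every node can compute its `y` from its `x` without communication, whatever the value of the
global parameter `θ`. -/
def Determines {n : ℕ} {Θ I O : Type} (x : Θ → Fin n → I) (y : Θ → Fin n → O) : Prop :=
  ∀ v ⦃θ θ'⦄, x θ v = x θ' v → y θ v = y θ' v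

section Realizes

variable {n b R R' N N' : ℕ} {Θ I J O X : Type}

theorem Determines.exists_eq_apply [Nonempty Θ] {x : Θ → Fin n → I} {y : Θ → Fin n → O}
    (h : Determines x y) : ∃ f : Fin n → I → O, ∀ θ v, y θ v = f v (x θ v) := by
  have hv (v : Fin n) : ∃ f : I → O, ∀ θ, y θ v = f (x θ v) := by
    have : Nonempty O := ‹Nonempty Θ›.map fun θ => y θ v
    obtain ⟨f, hf⟩ := (Function.factorsThrough_iff fun θ => y θ v).1 (h v)
    exact ⟨f, congrFun hf⟩
  choose f hf using hv
  exact ⟨f, fun θ v => hf v θ⟩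

theorem realizes_of_isEmpty [IsEmpty Θ] [Nonempty O] (b R N : ℕ) (x : Θ → Fin n → I)
    (y : Θ → Fin n → O) : Realizes b R N x y :=
  ⟨⟨Unit, fun _ _ => (), fun _ _ _ _ => none, fun _ _ _ _ => (),
    fun _ _ => Classical.arbitrary O⟩, isEmptyElim⟩

theorem Realizes.mono {x : Θ → Fin n → I} {y : Θ → Fin n → O} (h : Realizes b R N x y)
    (hN : N ≤ N') : Realizes b R N' x y :=
  h.imp fun _ hP θ => ⟨(hP θ).1, (hP θ).2.trans hN⟩

theorem Realizes.trans {x : Θ → Fin n → I} {y : Θ → Fin n → J} {z : Θ → Fin n → O}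
    (h : Realizes b R N x y) (h' : Realizes b R' N' y z) :
    Realizes b (R + R') (N + N') x z := by
  obtain ⟨P, hP⟩ := h
  obtain ⟨Q, hQ⟩ := h'
  refine ⟨P.seqComp R Q, fun θ => ?_⟩
  rw [CliqueProtocol.seqComp_result, CliqueProtocol.seqComp_messageCount, (hP θ).1]
  exact ⟨(hQ θ).1, add_le_add (hP θ).2 (hQ θ).2⟩

theorem Determines.realizes [Nonempty Θ] {x : Θ → Fin n → I} {y : Θ → Fin n → O}
    (h : Determines x y) (b : ℕ) : Realizes b 0 0 x y := by
  obtain ⟨f, hf⟩ := h.exists_eq_apply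
  exact ⟨⟨I, fun _ i => i, fun _ _ _ _ => none, fun _ _ s _ => s, f⟩,
    fun θ => ⟨funext fun v => (hf θ v).symm, le_of_eq (Finset.sum_range_zero _)⟩⟩

theorem Realizes.determines [Nonempty Θ] {x : Θ → Fin n → I} {y : Θ → Fin n → J}
    {z : Θ → Fin n → O} (h : Realizes b R N x y) (h' : Determines y z) :
    Realizes b R N x z :=
  h.trans (h'.realizes b)

variable [Nonempty Θ] {x : Θ → Fin n → I}

theorem realizes_oneRound [Finite X] (hX : Nat.card X ≤ n ^ b)
    {m : Θ → Fin n → Fin n → Option X} (hm : Determines x m) (hN : ∀ θ, numMessages (m θ) ≤ N) :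
    Realizes b 1 N x (fun θ v => (x θ v, fun u => m θ u v)) := by
  have := Fintype.ofFinite X
  obtain ⟨f, hf⟩ := hm.exists_eq_apply
  obtain ⟨e⟩ : Nonempty (X ↪ Fin (n ^ b)) :=
    Function.Embedding.nonempty_of_card_le (by simpa [Nat.card_eq_fintype_card] using hX)
  refine ⟨CliqueProtocol.oneRound f e, fun θ => ⟨funext fun v => ?_, ?_⟩⟩
  · simp only [CliqueProtocol.oneRound_result, hf]
  · refine (CliqueProtocol.oneRound_messageCount_le f e (x θ)).trans ?_
    simpa only [← hf] using hN θ

theorem realizes_virtualRound {C : ℕ} {Y : Type} [Finite Y]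
    (hY : (Nat.card Y + 1) ^ (C * C) ≤ n ^ b) {m : Θ → Fin n × Fin C → Fin n × Fin C → Option Y}
    (hm : Determines x fun θ u j => m θ (u, j)) (hN : ∀ θ, numMessages (m θ) ≤ N) :
    Realizes b 1 N x (fun θ v => (x θ v, fun a k => m θ a (v, k))) := by
  have hcard : Nat.card (Fin C → Fin C → Option Y) ≤ n ^ b := by
    simpa [Nat.card_fun, Finite.card_option, ← pow_mul] using hY
  have hbundle : Determines x fun θ u => bundle fun j => m θ (u, j) :=
    fun u θ θ' h => congrArg bundle (hm u h)
  refine (realizes_oneRound hcard hbundle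
    fun θ => (numMessages_bundle_le _).trans (hN θ)).determines fun v θ θ' h => ?_
  obtain ⟨hx, hb⟩ := Prod.mk.inj h
  have hbind (θ) (a : Fin n × Fin C) (k) :
      m θ a (v, k) = (bundle (fun j => m θ (a.1, j)) v).bind fun g => g a.2 k :=
    (bundle_bind (fun j => m θ (a.1, j)) a.2 (v, k)).symm
  refine Prod.ext hx (funext₂ fun a k => ?_)
  change m θ a (v, k) = m θ' a (v, k)
  rw [hbind, hbind, congrFun hb a.1]

end Realizes

open Classical in
/-- Some element that satisfies `P`, if there is one. -/
noncomputable def pick {α : Type} (P : α → Prop) : Option α :=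
  if h : ∃ a, P a then some h.choose else none

theorem pick_eq_some_iff {α : Type} {P : α → Prop} (hP : ∀ ⦃a a'⦄, P a → P a' → a = a') {a : α} :
    pick P = some a ↔ P a := by
  unfold pick
  split_ifs with h
  · rw [Option.some.injEq]
    exact ⟨fun ha => ha ▸ h.choose_spec, hP h.choose_spec⟩
  · simpa using fun ha => h ⟨a, ha⟩

/-- The layout of a routing of packets, numbered by `K` and with contents in `D`, through relays:
packet `j` leaves `src j` in `T` chunks from the alphabet `Z` and travels through the `T` relays of
the block `blk j`.  The chunks encode the number of the packet along with its content. -/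
structure RelayRoute (W B K D Z : Type) (T : ℕ) where
  relay : B × Fin T ↪ W
  encode : K × D ↪ (Fin T → Z)
  src : K → W
  blk : K → B
  src_blk_injective : Function.Injective fun j => (src j, blk j)

namespace RelayRoute

variable {W B K D Z : Type} {T : ℕ} (ρ : RelayRoute W B K D Z T) {pk : K → Option (W × D)}

/-- In the packets `pk`, which consist of a destination and a content, no two packets of the same
block have the same destination. -/
def DistinctDestinations (pk : K → Option (W × D)) : Prop :=
  ∀ ⦃j j' w d d'⦄, ρ.blk j = ρ.blk j' → pk j = some (w, d) → pk j' = some (w, d') → j = j'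

/-- The message from the source `a` to the relay `c`: the destination and a chunk of a packet. -/
noncomputable def toRelay (pk : K → Option (W × D)) (a c : W) : Option (W × Z) :=
  pick fun q => ∃ j t d, pk j = some (q.1, d) ∧ ρ.src j = a ∧ ρ.relay (ρ.blk j, t) = c ∧
    ρ.encode (j, d) t = q.2

theorem toRelay_eq_some_iff {a c : W} {q : W × Z} :
    ρ.toRelay pk a c = some q ↔ ∃ j t d, pk j = some (q.1, d) ∧ ρ.src j = a ∧
      ρ.relay (ρ.blk j, t) = c ∧ ρ.encode (j, d) t = q.2 := by
  refine pick_eq_some_iff ?_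
  rintro ⟨w, z⟩ ⟨w', z'⟩ ⟨j, t, d, hj, rfl, hc, rfl⟩ ⟨j', t', d', hj', hs, rfl, rfl⟩
  obtain ⟨hb, rfl⟩ := Prod.mk.inj (ρ.relay.injective hc)
  obtain rfl : j = j' := ρ.src_blk_injective (Prod.ext hs.symm hb)
  obtain ⟨rfl, rfl⟩ : w = w' ∧ d = d' := by simpa using hj.symm.trans hj'
  rfl

theorem toRelay_congr {pk' : K → Option (W × D)} {a : W} (h : ∀ j, ρ.src j = a → pk j = pk' j) :
    ρ.toRelay pk a = ρ.toRelay pk' a := by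
  ext c q
  simp only [toRelay_eq_some_iff]
  refine exists_congr fun j => exists_congr fun t => exists_congr fun d => ?_
  refine and_congr_left fun hj => ?_
  rw [h j hj.1]

theorem numMessages_toRelay_le [Fintype W] [Fintype K] (pk : K → Option (W × D)) :
    numMessages (ρ.toRelay pk) ≤ Fintype.card K * T := by
  refine (numMessages_le_card (fun i : K × Fin T => (ρ.src i.1, ρ.relay (ρ.blk i.1, i.2)))
    fun a c h => ?_).trans_eq (by simp)
  obtain ⟨q, hq⟩ := Option.isSome_iff_exists.1 h
  obtain ⟨j, t, d, -, hs, hc, -⟩ := ρ.toRelay_eq_some_iff.1 hq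
  exact ⟨(j, t), Prod.ext hs hc⟩

/-- The message to `w` of a relay that has received `msg`: the chunk with the destination `w`. -/
noncomputable def forward (msg : W → Option (W × Z)) (w : W) : Option (W × Z) :=
  pick fun q => q.1 = w ∧ ∃ a, msg a = some q

variable (hpk : ρ.DistinctDestinations pk)
include hpk

theorem forward_toRelay_eq_some_iff {c w : W} {q : W × Z} :
    forward (fun a => ρ.toRelay pk a c) w = some q ↔ q.1 = w ∧
      ∃ j t d, pk j = some (w, d) ∧ ρ.relay (ρ.blk j, t) = c ∧ ρ.encode (j, d) t = q.2 := by
  have hiff (q : W × Z) : (q.1 = w ∧ ∃ a, ρ.toRelay pk a c = some q) ↔ q.1 = w ∧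
      ∃ j t d, pk j = some (w, d) ∧ ρ.relay (ρ.blk j, t) = c ∧ ρ.encode (j, d) t = q.2 := by
    refine and_congr_right ?_
    rintro rfl
    simp only [toRelay_eq_some_iff]
    exact ⟨fun ⟨_, j, t, d, hj, _, h⟩ => ⟨j, t, d, hj, h⟩,
      fun ⟨j, t, d, hj, h⟩ => ⟨_, j, t, d, hj, rfl, h⟩⟩
  rw [← hiff]
  refine pick_eq_some_iff ?_
  simp only [hiff]
  rintro ⟨w, z⟩ ⟨w', z'⟩ ⟨rfl, j, t, d, hj, hc, rfl⟩ ⟨rfl, j', t', d', hj', rfl, rfl⟩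
  obtain ⟨hb, rfl⟩ := Prod.mk.inj (ρ.relay.injective hc)
  obtain rfl := hpk hb hj hj'
  obtain rfl : d = d' := by simpa using hj.symm.trans hj'
  rfl

theorem numMessages_forward_le [Fintype W] [Fintype K] :
    numMessages (fun c => forward fun a => ρ.toRelay pk a c) ≤ Fintype.card K * T := by
  refine (numMessages_le_card (fun i : K × Fin T => (ρ.relay (ρ.blk i.1, i.2),
    (pk i.1).elim (ρ.src i.1) Prod.fst)) fun c w h => ?_).trans_eq (by simp)
  obtain ⟨q, hq⟩ := Option.isSome_iff_exists.1 h
  obtain ⟨-, j, t, d, hj, hc, -⟩ := (ρ.forward_toRelay_eq_some_iff hpk).1 hq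
  exact ⟨(j, t), by simp [hj, hc]⟩

theorem packet_eq_some_iff [NeZero T] {w : W} {j : K} {d : D} :
    pk j = some (w, d) ↔ ∀ t, forward (fun a => ρ.toRelay pk a (ρ.relay (ρ.blk j, t))) w =
      some (w, ρ.encode (j, d) t) := by
  simp only [ρ.forward_toRelay_eq_some_iff hpk, true_and]
  refine ⟨fun h t => ⟨j, t, d, h, rfl, rfl⟩, fun h => ?_⟩
  have hchunk (t : Fin T) : ∃ j' d', pk j' = some (w, d') ∧ ρ.blk j' = ρ.blk j ∧
      ρ.encode (j', d') t = ρ.encode (j, d) t := by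
    obtain ⟨j', t', d', hj', hc, he⟩ := h t
    obtain ⟨hb, rfl⟩ := Prod.mk.inj (ρ.relay.injective hc)
    exact ⟨j', d', hj', hb, he⟩
  obtain ⟨j₀, d₀, hj₀, hb₀, -⟩ := hchunk 0
  have henc : ρ.encode (j₀, d₀) = ρ.encode (j, d) := funext fun t => by
    obtain ⟨j', d', hj', hb', he⟩ := hchunk t
    obtain rfl := hpk (hb₀.trans hb'.symm) hj₀ hj'
    obtain rfl : d₀ = d' := by simpa using hj₀.symm.trans hj'
    exact he
  obtain ⟨rfl, rfl⟩ := Prod.mk.inj (ρ.encode.injective henc)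
  exact hj₀

end RelayRoute

section Routing

variable {n b C T : ℕ} {Θ I B K D Z : Type} [Nonempty Θ] [Fintype K] [Finite Z] [NeZero T]

/-- The numbers and contents of the packets addressed to the virtual nodes of `v`. -/
def inbox (pk : K → Option ((Fin n × Fin C) × D)) (v : Fin n) : Set (K × D) :=
  {q | ∃ k, pk q.1 = some ((v, k), q.2)}

theorem realizes_route (hZ : (Nat.card ((Fin n × Fin C) × Z) + 1) ^ (C * C) ≤ n ^ b)
    (ρ : RelayRoute (Fin n × Fin C) B K D Z T) {x : Θ → Fin n → I}
    {pk : Θ → K → Option ((Fin n × Fin C) × D)}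
    (hloc : ∀ ⦃θ θ'⦄ j, x θ (ρ.src j).1 = x θ' (ρ.src j).1 → pk θ j = pk θ' j)
    (hdist : ∀ θ, ρ.DistinctDestinations (pk θ)) :
    Realizes b 2 (2 * (Fintype.card K * T)) x fun θ v => (x θ v, inbox (pk θ) v) := by
  have hsend : Determines x fun θ u j => ρ.toRelay (pk θ) (u, j) := fun u θ θ' h =>
    funext fun j => ρ.toRelay_congr fun i hi => hloc i (by rwa [hi])
  have hforward : Determines
      (fun θ v => (x θ v, fun a (k : Fin C) => ρ.toRelay (pk θ) a (v, k)))
      fun θ v k => RelayRoute.forward fun a => ρ.toRelay (pk θ) a (v, k) := fun v θ θ' h =>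
    funext fun k => congrArg RelayRoute.forward (funext fun a =>
      congrFun (congrFun (Prod.mk.inj h).2 a) k)
  rw [two_mul]
  refine ((realizes_virtualRound hZ hsend fun θ => ρ.numMessages_toRelay_le (pk θ)).trans
    (realizes_virtualRound (m := fun θ c => RelayRoute.forward fun a => ρ.toRelay (pk θ) a c)
      hZ hforward fun θ => ρ.numMessages_forward_le (hdist θ))).determines fun v θ θ' h => ?_
  obtain ⟨⟨hx, -⟩, hrecv⟩ := by simpa only [Prod.mk.injEq] using h
  refine Prod.ext hx (Set.ext fun q => exists_congr fun k => ?_)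
  rw [ρ.packet_eq_some_iff (hdist θ), ρ.packet_eq_some_iff (hdist θ')]
  exact forall_congr' fun t => by rw [congrFun (congrFun hrecv _) k]

end Routing

section RepSum

variable {V X Y A : Type} [Fintype V] [LinearOrder V] [DecidableEq X] [AddCommMonoid A]

/-- The smallest element of the fiber of `f` through `a`, which serves as its representative. -/
def fiberMin (f : V → X) (a : V) : V :=
  ({b | f b = f a} : Finset V).min' ⟨a, by simp⟩

theorem apply_fiberMin (f : V → X) (a : V) : f (fiberMin f a) = f a :=
  (Finset.mem_filter.1 (Finset.min'_mem ({b | f b = f a} : Finset V) _)).2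

theorem fiberMin_congr {f f' : V → X} {a a' : V} (h : ∀ b, f b = f a ↔ f' b = f' a') :
    fiberMin f a = fiberMin f' a' := by
  simp only [fiberMin, h]

theorem fiberMin_eq_of_apply_eq {f : V → X} {a a' : V} (h : f a = f a') :
    fiberMin f a = fiberMin f a' :=
  fiberMin_congr fun b => by rw [h]

/-- The sum of `val` over the fiber of `f` through `a` if `a` represents this fiber. -/
def repSum (f : V → X) (val : V → A) (a : V) : Option A :=
  if fiberMin f a = a then some (∑ b with f b = f a, val b) else none

theorem repSum_congr {f f' : V → X} {val val' : V → A} {a : V}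
    (hf : ∀ b, f b = f a ↔ f' b = f' a) (hval : ∀ b, f b = f a → val b = val' b) :
    repSum f val a = repSum f' val' a := by
  have hsum : ∑ b with f b = f a, val b = ∑ b with f' b = f' a, val' b :=
    Finset.sum_congr (by simp only [hf]) fun b hb => hval b ((hf b).2 (by simpa using hb))
  simp only [repSum, fiberMin_congr hf, hsum]

theorem eq_of_repSum_eq_some {f : V → X} {val : V → A} {a a' : V} {s s' : A}
    (ha : repSum f val a = some s) (ha' : repSum f val a' = some s') (h : f a = f a') :
    a = a' := by
  simp only [repSum, Option.ite_none_right_eq_some] at ha ha'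
  rw [← ha.1, ← ha'.1, fiberMin_eq_of_apply_eq h]

theorem sum_repSum [DecidableEq Y] {f : V → X} {g : V → Y} (hg : ∀ a b, f a = f b → g a = g b)
    (val : V → A) (y : Y) :
    ∑ a with g a = y, (repSum f val a).getD 0 = ∑ b with g b = y, val b := by
  have hmaps : ∀ b ∈ ({b | g b = y} : Finset V), fiberMin f b ∈ ({b | g b = y} : Finset V) := by
    simpa using fun b hb => (hg _ _ (apply_fiberMin f b)).trans hb
  rw [← Finset.sum_fiberwise_of_maps_to hmaps val]
  refine Finset.sum_congr rfl fun a ha => ?_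
  replace ha : g a = y := by simpa using ha
  have hrep {b : V} (hb : fiberMin f b = a) : f b = f a :=
    (apply_fiberMin f b).symm.trans (congrArg f hb)
  by_cases h : fiberMin f a = a
  · have hfiber (b : V) : f b = f a ↔ g b = y ∧ fiberMin f b = a :=
      ⟨fun hb => ⟨(hg _ _ hb).trans ha, (fiberMin_eq_of_apply_eq hb).trans h⟩, fun hb => hrep hb.2⟩
    simp only [repSum, h, if_true, Option.getD_some, hfiber, Finset.filter_filter]
  · have hempty : ∀ b, fiberMin f b ≠ a := fun b hb =>
      h ((fiberMin_eq_of_apply_eq (hrep hb)).symm.trans hb)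
    simp [repSum, h, hempty]

end RepSum

/-- The resources for the summation at labels of values in `A` with indices in `ι`, on `n` nodes
with `C` virtual nodes each: for every block in `B`, `T` relays; for every index and each of `T`
groups of nodes, a virtual node as helper and a block; the group of each node and its place in the
group, which is an element of `B` as it serves to shift blocks; and a code for the packets. -/
structure RelayPlan (n C T : ℕ) (ι B A Z : Type) where
  relay : B × Fin T ↪ Fin n × Fin C
  helper : ι × Fin T ↪ Fin n × Fin C
  base : ι × Fin T ↪ B
  place : Fin n ↪ Fin T × B
  encode : (Fin n × ι) × (Fin n × A) ↪ (Fin T → Z)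

namespace RelayPlan

variable {n C T b : ℕ} {ι B A Z Θ I : Type}

/-- The group of a node. -/
def group (π : RelayPlan n C T ι B A Z) (u : Fin n) : Fin T := (π.place u).1

section Blocks

variable [NeZero T] [Add B] [IsCancelAdd B] (π : RelayPlan n C T ι B A Z)

/-- The block of an index shifted by the place of a node in its group.  Thanks to the shift, the
members of a group, which share their helpers, use different blocks for each index, while the
packets of one node still use different blocks. -/
def shiftedBlock (j : Fin n × ι) : B := π.base (j.2, 0) + (π.place j.1).2

theorem eq_of_shiftedBlock_eq_of_node_eq {j j' : Fin n × ι}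
    (h : π.shiftedBlock j = π.shiftedBlock j') (hj : j.1 = j'.1) : j = j' := by
  rw [shiftedBlock, shiftedBlock, hj, add_left_inj] at h
  exact Prod.ext hj (Prod.mk.inj (π.base.injective h)).1

theorem eq_of_shiftedBlock_eq_of_helper_eq {j j' : Fin n × ι}
    (h : π.shiftedBlock j = π.shiftedBlock j')
    (hj : π.helper (j.2, π.group j.1) = π.helper (j'.2, π.group j'.1)) : j = j' := by
  obtain ⟨hindex, hgroup⟩ := Prod.mk.inj (π.helper.injective hj)
  rw [shiftedBlock, shiftedBlock, hindex, add_right_inj] at h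
  exact Prod.ext (π.place.injective (Prod.ext hgroup h)) hindex

end Blocks

section Routes

variable [NeZero C] [NeZero T] (π : RelayPlan n C T ι B A Z)

/-- The virtual node that sends and receives the own packets of `u`. -/
def home (C : ℕ) [NeZero C] (u : Fin n) : Fin n × Fin C := (u, 0)

theorem home_injective : Function.Injective (home C : Fin n → Fin n × Fin C) :=
  fun _ _ h => (Prod.mk.inj h).1

/-- The route with one block per index, from the nodes. -/
def indexRoute : RelayRoute (Fin n × Fin C) B (Fin n × ι) (Fin n × A) Z T where
  relay := π.relay
  encode := π.encode
  src j := home C j.1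
  blk j := π.base (j.2, 0)
  src_blk_injective _ _ h :=
    Prod.ext (home_injective (Prod.mk.inj h).1)
      (Prod.mk.inj (π.base.injective (Prod.mk.inj h).2)).1

/-- The route with one block per index and group, from the nodes. -/
def groupRoute : RelayRoute (Fin n × Fin C) B (Fin n × ι) (Fin n × A) Z T where
  relay := π.relay
  encode := π.encode
  src j := home C j.1
  blk j := π.base (j.2, π.group j.1)
  src_blk_injective _ _ h :=
    Prod.ext (home_injective (Prod.mk.inj h).1)
      (Prod.mk.inj (π.base.injective (Prod.mk.inj h).2)).1

/-- The route from the nodes to the helpers of their groups. -/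
def toHelperRoute [Add B] [IsCancelAdd B] :
    RelayRoute (Fin n × Fin C) B (Fin n × ι) (Fin n × A) Z T where
  relay := π.relay
  encode := π.encode
  src j := home C j.1
  blk := π.shiftedBlock
  src_blk_injective _ _ h := π.eq_of_shiftedBlock_eq_of_node_eq (Prod.mk.inj h).2
    (home_injective (Prod.mk.inj h).1)

/-- The route from the helpers back to the members of their groups. -/
def fromHelperRoute [Add B] [IsCancelAdd B] :
    RelayRoute (Fin n × Fin C) B (Fin n × ι) (Fin n × A) Z T where
  relay := π.relay
  encode := π.encode
  src j := π.helper (j.2, π.group j.1)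
  blk := π.shiftedBlock
  src_blk_injective _ _ h := π.eq_of_shiftedBlock_eq_of_helper_eq (Prod.mk.inj h).2
    (Prod.mk.inj h).1

end Routes

section LabelSum

variable [AddCommMonoid A] (π : RelayPlan n C T ι B A Z)

/-- The packets to the helpers, each with a label and a value. -/
def valuePacket (label : ι → Fin n → Fin n) (val : ι → Fin n → A) (j : Fin n × ι) :
    Option ((Fin n × Fin C) × (Fin n × A)) :=
  some (π.helper (j.2, π.group j.1), (label j.2 j.1, val j.2 j.1))

/-- The sum of the values with index `k` in the group of `u` that have the same label as `u`, if
`u` is the representative of the nodes that contribute to this sum. -/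
def groupSum (label : ι → Fin n → Fin n) (val : ι → Fin n → A) (k : ι) (u : Fin n) : Option A :=
  repSum (fun u => (π.group u, label k u)) (val k) u

variable {label label' : ι → Fin n → Fin n} {val val' : ι → Fin n → A}

theorem groupSum_eq_of_inbox_eq {k : ι} {u : Fin n}
    (h : inbox (π.valuePacket label val) (π.helper (k, π.group u)).1 =
      inbox (π.valuePacket label' val') (π.helper (k, π.group u)).1) :
    π.groupSum label val k u = π.groupSum label' val' k u := by
  have hmember (u' : Fin n) (hu' : π.group u' = π.group u) :
      label k u' = label' k u' ∧ val k u' = val' k u' := by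
    have hmem : ((u', k), (label k u', val k u')) ∈
        inbox (π.valuePacket label' val') (π.helper (k, π.group u)).1 :=
      h ▸ ⟨(π.helper (k, π.group u)).2, by rw [valuePacket, hu']⟩
    obtain ⟨_, hpacket⟩ := hmem
    simpa [valuePacket, eq_comm] using (congrArg Prod.snd (Option.some.inj hpacket))
  refine repSum_congr (fun u' => ?_) fun u' hu' => (hmember u' (Prod.mk.inj hu').1).2
  rw [Prod.mk.injEq, Prod.mk.injEq]
  exact and_congr_right fun hu' => by rw [(hmember u' hu').1, (hmember u rfl).1]

variable [NeZero C]

/-- The packets in which `dest k u` receives the `groupSum` of the representative `u`. -/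
def sumPacket (label : ι → Fin n → Fin n) (val : ι → Fin n → A) (dest : ι → Fin n → Fin n)
    (j : Fin n × ι) : Option ((Fin n × Fin C) × (Fin n × A)) :=
  (π.groupSum label val j.2 j.1).map fun a => (home C (dest j.2 j.1), (j.1, a))

theorem mem_inbox_sumPacket {dest : ι → Fin n → Fin n} {v u : Fin n} {k : ι} {a : A} :
    ((u, k), (u, a)) ∈ inbox (π.sumPacket label val dest) v ↔
      dest k u = v ∧ π.groupSum label val k u = some a := by
  simp [inbox, sumPacket, home, and_comm]

theorem sum_inbox_sumPacket (k : ι) (v : Fin n) :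
    ∑ u, (pick fun a => ((u, k), (u, a)) ∈ inbox (π.sumPacket label val label) v).getD 0 =
      ∑ u with label k u = v, val k u := by
  rw [← sum_repSum (f := fun u => (π.group u, label k u)) (fun _ _ h => (Prod.mk.inj h).2),
    Finset.sum_filter]
  refine Finset.sum_congr rfl fun u _ => ?_
  simp only [mem_inbox_sumPacket]
  by_cases hu : label k u = v
  · have hpick : (pick fun a => π.groupSum label val k u = some a) = π.groupSum label val k u :=
      Option.ext fun a => pick_eq_some_iff fun _ _ h h' => Option.some.inj (h.symm.trans h')
    simp only [hu, true_and, if_true, hpick]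
    rfl
  · simp [hu, pick]

end LabelSum

section Rounds

variable [NeZero C] [NeZero T] [Nonempty Θ] [Fintype ι] [Finite Z] [AddCommMonoid A]
  (hZ : (Nat.card ((Fin n × Fin C) × Z) + 1) ^ (C * C) ≤ n ^ b) (π : RelayPlan n C T ι B A Z)
  {x : Θ → Fin n → I} {label : Θ → ι → Fin n → Fin n} {val : Θ → ι → Fin n → A}
  (hlabel : Determines x fun θ v k => label θ k v) (hval : Determines x fun θ v k => val θ k v)

include hZ hlabel hval in
theorem realizes_groupSum [Add B] [IsCancelAdd B] :
    Realizes b 4 (4 * (Fintype.card (Fin n × ι) * T)) x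
      fun θ v => (x θ v, fun k => π.groupSum (label θ) (val θ) k v) := by
  have toHelper : Realizes b 2 (2 * (Fintype.card (Fin n × ι) * T)) x
      fun θ v => (x θ v, inbox (π.valuePacket (label θ) (val θ)) v) := by
    refine realizes_route hZ π.toHelperRoute (fun θ θ' j h => ?_) fun θ j j' w d d' hb hj hj' => ?_
    · have hl := congrFun (hlabel _ h) j.2
      have hv := congrFun (hval _ h) j.2
      exact congrArg (fun d => some (π.helper (j.2, π.group j.1), d)) (Prod.ext hl hv)
    · have hw := congrArg Prod.fst (Option.some.inj hj)
      have hw' := congrArg Prod.fst (Option.some.inj hj')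
      exact π.eq_of_shiftedBlock_eq_of_helper_eq hb (hw.trans hw'.symm)
  have fromHelper : Realizes b 2 (2 * (Fintype.card (Fin n × ι) * T))
      (fun θ v => (x θ v, inbox (π.valuePacket (label θ) (val θ)) v))
      fun θ v => ((x θ v, inbox (π.valuePacket (label θ) (val θ)) v),
        inbox (π.sumPacket (label θ) (val θ) fun _ u => u) v) := by
    refine realizes_route hZ π.fromHelperRoute (fun θ θ' j h => ?_)
      fun θ j j' w d d' hb hj hj' => ?_
    · simp only [sumPacket, π.groupSum_eq_of_inbox_eq (Prod.mk.inj h).2]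
    · obtain ⟨_, -, h⟩ := Option.map_eq_some_iff.1 hj
      obtain ⟨_, -, h'⟩ := Option.map_eq_some_iff.1 hj'
      refine π.eq_of_shiftedBlock_eq_of_node_eq hb (home_injective (C := C) ?_)
      exact (Prod.mk.inj h).1.trans (Prod.mk.inj h').1.symm
  rw [show 4 * (Fintype.card (Fin n × ι) * T) = 2 * (Fintype.card (Fin n × ι) * T) +
    2 * (Fintype.card (Fin n × ι) * T) by ring]
  refine (toHelper.trans fromHelper).determines fun v θ θ' h => ?_
  obtain ⟨⟨hx, -⟩, hinbox⟩ := by simpa only [Prod.mk.injEq] using h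
  refine Prod.ext hx (funext fun k => Option.ext fun a => ?_)
  simpa [mem_inbox_sumPacket] using Set.ext_iff.1 hinbox ((v, k), (v, a))

include hZ π hlabel hval in
theorem realizes_labelSum [Add B] [IsCancelAdd B] :
    Realizes b 6 (6 * (Fintype.card (Fin n × ι) * T)) x
      fun θ v => (x θ v, fun k => ∑ u with label θ k u = v, val θ k u) := by
  have toLabel : Realizes b 2 (2 * (Fintype.card (Fin n × ι) * T))
      (fun θ v => (x θ v, fun k => π.groupSum (label θ) (val θ) k v))
      fun θ v => ((x θ v, fun k => π.groupSum (label θ) (val θ) k v),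
        inbox (π.sumPacket (label θ) (val θ) (label θ)) v) := by
    refine realizes_route hZ π.groupRoute (fun θ θ' j h => ?_)
      fun θ j j' w d d' hb hj hj' => ?_
    · obtain ⟨hx, hsum⟩ := Prod.mk.inj h
      have hl := congrFun (hlabel _ hx) j.2
      have hs := congrFun hsum j.2
      simp only [sumPacket]
      exact congrArg₂ (fun l o => Option.map (fun a => (home C l, (j.1, a))) o) hl hs
    · obtain ⟨s, hs, h⟩ := Option.map_eq_some_iff.1 hj
      obtain ⟨s', hs', h'⟩ := Option.map_eq_some_iff.1 hj'
      obtain ⟨u, k⟩ := j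
      obtain ⟨u', k'⟩ := j'
      obtain ⟨rfl, hgroup⟩ := Prod.mk.inj (π.base.injective hb)
      have hl := home_injective ((Prod.mk.inj h).1.trans (Prod.mk.inj h').1.symm)
      exact congrArg (·, k) (eq_of_repSum_eq_some hs hs' (Prod.ext hgroup hl))
  rw [show 6 * (Fintype.card (Fin n × ι) * T) = 4 * (Fintype.card (Fin n × ι) * T) +
    2 * (Fintype.card (Fin n × ι) * T) by ring]
  refine ((π.realizes_groupSum hZ hlabel hval).trans toLabel).determines fun v θ θ' h => ?_
  obtain ⟨⟨hx, -⟩, hinbox⟩ := by simpa only [Prod.mk.injEq] using h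
  refine Prod.ext hx (funext fun k => ?_)
  simp only [← π.sum_inbox_sumPacket, hinbox]

end Rounds

end RelayPlan

section Rounds

variable {n b : ℕ} {Θ I ι : Type} [Nonempty Θ] [Fintype ι] {x : Θ → Fin n → I}

theorem realizes_fibers (hb : 2 ^ Fintype.card ι ≤ n ^ b) {label : Θ → ι → Fin n → Fin n}
    (hlabel : Determines x fun θ v i => label θ i v) :
    Realizes b 1 (n * Fintype.card ι) x
      fun θ v => (x θ v, fun u i => label θ i u = v) := by
  let message (label : ι → Fin n → Fin n) (u v : Fin n) : Option (Set ι) :=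
    pick fun s => s.Nonempty ∧ s = {i | label i u = v}
  have hmessage {label : ι → Fin n → Fin n} {u v : Fin n} {s : Set ι} :
      message label u v = some s ↔ s.Nonempty ∧ s = {i | label i u = v} :=
    pick_eq_some_iff fun _ _ h h' => h.2.trans h'.2.symm
  have hmem (label : ι → Fin n → Fin n) (u v : Fin n) (i : ι) :
      label i u = v ↔ ∃ s, message label u v = some s ∧ i ∈ s := by
    simp only [hmessage]
    exact ⟨fun hi => ⟨_, ⟨⟨i, hi⟩, rfl⟩, hi⟩, fun ⟨_, ⟨_, hs⟩, hi⟩ => (hs ▸ hi :)⟩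
  have hlocal : Determines x fun θ => message (label θ) := fun u θ θ' h => by
    have hu (i : ι) : label θ i u = label θ' i u := congrFun (hlabel u h) i
    simp only [message, hu]
  have hcount (θ : Θ) : numMessages (message (label θ)) ≤ n * Fintype.card ι := by
    refine (numMessages_le_card (fun j : Fin n × ι => (j.1, label θ j.2 j.1))
      fun u v h => ?_).trans_eq (by simp)
    obtain ⟨s, hs⟩ := Option.isSome_iff_exists.1 h
    obtain ⟨⟨i, hi⟩, rfl⟩ := hmessage.1 hs
    exact ⟨(u, i), Prod.ext rfl hi⟩
  refine (realizes_oneRound (by simpa using hb) hlocal hcount).determines fun v θ θ' h => ?_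
  obtain ⟨hx, hreceived⟩ := Prod.mk.inj h
  refine Prod.ext hx (funext₂ fun u i => propext ?_)
  change label θ i u = v ↔ label θ' i u = v
  rw [hmem, hmem, congrFun hreceived u]

theorem realizes_notify (hb : 1 ≤ n ^ b) {r : Θ → Fin n → Fin n → Prop} (hr : Determines x r)
    {f : Θ → ι → Fin n × Fin n} (hf : ∀ θ u v, r θ u v → ∃ i, f θ i = (u, v)) :
    Realizes b 1 (Fintype.card ι) x fun θ v => (x θ v, fun u => r θ u v) := by
  have hiff {p : Prop} : (pick fun _ : Unit => p) = some () ↔ p :=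
    pick_eq_some_iff fun _ _ _ _ => rfl
  have hlocal : Determines x fun θ u v => pick fun _ : Unit => r θ u v := fun u θ θ' h =>
    congrArg (fun s v => pick fun _ : Unit => s v) (hr u h)
  refine (realizes_oneRound (by simpa using hb) hlocal
    fun θ => numMessages_le_card (f θ) fun u v h => ?_).determines fun v θ θ' h => ?_
  · obtain ⟨⟨⟩, hp⟩ := Option.isSome_iff_exists.1 h
    exact hf θ u v (hiff.1 hp)
  · obtain ⟨hx, hreceived⟩ := Prod.mk.inj h
    refine Prod.ext hx (funext fun u => propext ?_)
    exact hiff.symm.trans ((iff_of_eq (congrArg (· = some ()) (congrFun hreceived u))).trans hiff)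

theorem RelayPlan.realizes_announce {C T : ℕ} [NeZero C] [NeZero T] {B A Z : Type} [Finite Z]
    [Zero A] (π : RelayPlan n C T ι B A Z)
    (hZ : (Nat.card ((Fin n × Fin C) × Z) + 1) ^ (C * C) ≤ n ^ b)
    {edge : Θ → ι → Fin n → Option (Fin n × Fin n)}
    (hedge : Determines x fun θ v k => edge θ k v)
    (hdisjoint : ∀ ⦃θ k u u' a c c'⦄, edge θ k u = some (a, c) → edge θ k u' = some (a, c') →
      u = u') :
    Realizes b 2 (2 * (Fintype.card (Fin n × ι) * T)) x
      fun θ a => (x θ a, fun u k c => edge θ k u = some (a, c)) := by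
  let packet (θ : Θ) (j : Fin n × ι) : Option ((Fin n × Fin C) × (Fin n × A)) :=
    (edge θ j.2 j.1).map fun q => (home C q.1, (q.2, 0))
  refine (realizes_route hZ π.indexRoute (pk := packet) (fun θ θ' j h => ?_)
    fun θ j j' w d d' hb hj hj' => ?_).determines fun a θ θ' h => ?_
  · exact congrArg (Option.map _) (congrFun (hedge _ h) j.2)
  · obtain ⟨⟨a, c⟩, hq, h⟩ := Option.map_eq_some_iff.1 hj
    obtain ⟨⟨a', c'⟩, hq', h'⟩ := Option.map_eq_some_iff.1 hj'
    have hindex := (Prod.mk.inj (π.base.injective hb)).1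
    obtain rfl : a = a' := home_injective ((Prod.mk.inj h).1.trans (Prod.mk.inj h').1.symm)
    rw [hindex] at hq
    exact Prod.ext (hdisjoint hq hq') hindex
  · obtain ⟨hx, hinbox⟩ := Prod.mk.inj h
    have hmem (θ u k c) : ((u, k), (c, 0)) ∈ inbox (packet θ) a ↔ edge θ k u = some (a, c) := by
      simp [inbox, packet, home, and_comm]
    refine Prod.ext hx (funext₃ fun u k c => propext ?_)
    exact (hmem θ u k c).symm.trans (hinbox ▸ hmem θ' u k c)

end Rounds

section Components

variable {V : Type} [Fintype V] (F : SimpleGraph V) (w : Sym2 V → ℕ) (i : ℕ) {u v : V}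

theorem mem_phaseComp : u ∈ phaseComp F w i v ↔ (boruvka F w i).Reachable v u := by
  simp [phaseComp]

variable {F w i}

theorem phaseComp_eq_of_mem (h : u ∈ phaseComp F w i v) :
    phaseComp F w i u = phaseComp F w i v := by
  rw [mem_phaseComp] at h
  ext x
  simp only [mem_phaseComp]
  exact ⟨h.trans, h.symm.trans⟩

theorem phaseWeight_eq_of_mem (h : u ∈ phaseComp F w i v) :
    phaseWeight F w i u = phaseWeight F w i v := by
  simp only [phaseWeight, phaseComp_eq_of_mem h]

variable [LinearOrder V]

theorem phaseLeader_mem (v : V) : phaseLeader F w i v ∈ phaseComp F w i v :=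
  Finset.min'_mem _ _

theorem mem_phaseComp_iff_phaseLeader_eq :
    u ∈ phaseComp F w i v ↔ phaseLeader F w i u = phaseLeader F w i v := by
  refine ⟨fun h => by simp only [phaseLeader, phaseComp_eq_of_mem h], fun h => ?_⟩
  have hcomp : phaseComp F w i u = phaseComp F w i v := by
    rw [← phaseComp_eq_of_mem (phaseLeader_mem u), h, phaseComp_eq_of_mem (phaseLeader_mem v)]
  exact hcomp ▸ mem_phaseComp_self F w i u

end Components

/-- What determines the course of the gathering and sampling step: the parameter that is unknown to
the individual nodes. -/
structure StepInput (n : ℕ) (Seed : Type) where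
  seed : Seed
  G : SimpleGraph (Fin n)
  F : SimpleGraph (Fin n)
  w : Sym2 (Fin n) → ℕ

/-- A phase and the number of a sketch. -/
abbrev SketchIndex (n β : ℕ) : Type := Fin (numPhases n) × Fin β

namespace StepInput

variable {n β : ℕ} {Seed A : Type} [AddCommGroup A]

instance [Nonempty Seed] : Nonempty (StepInput n Seed) :=
  ‹Nonempty Seed›.map fun r => ⟨r, ⊥, ⊥, 0⟩

section Definitions

variable (S : SketchScheme n β Seed A) (θ : StepInput n Seed)

/-- The leader of the phase-`i` component of `v`. -/
noncomputable def leader (i : ℕ) (v : Fin n) : Fin n :=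
  phaseLeader θ.F θ.w i v

/-- The knowledge of the nodes before the step. -/
noncomputable def view : Fin n → LocalView n β Seed A :=
  localView S θ.seed θ.G θ.F θ.w

/-- The sketch of the node `v` with index `k`. -/
noncomputable def sketch (k : SketchIndex n β) (v : Fin n) : A :=
  S.nodeSketch θ.seed θ.G θ.F θ.w k.1 k.2 v

/-- The sketch with index `k` of the component with leader `v`; it is `0` if `v` is no leader. -/
noncomputable def leaderSketch (k : SketchIndex n β) (v : Fin n) : A :=
  ∑ u with θ.leader k.1 u = v, θ.sketch S k u

/-- The edge read off the sketch with index `k` of the component with leader `v`, oriented to leave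
the component.  Whether it is an edge of `G`, and light enough, the leader cannot tell. -/
noncomputable def candidate (k : SketchIndex n β) (v : Fin n) : Option (Fin n × Fin n) :=
  pick fun q => S.sample θ.seed k.1 k.2 (θ.leaderSketch S k v) = some s(q.1, q.2) ∧
    θ.leader k.1 q.1 = v ∧ θ.leader k.1 q.2 ≠ v

/-- The edge `s(a, c)` has been sampled from a sketch of a component that contains `a`. -/
def SampledFrom (a c : Fin n) : Prop :=
  ∃ u k, θ.candidate S k u = some (a, c) ∧ θ.G.Adj a c ∧
    (θ.w s(a, c) : ℕ∞) ≤ phaseWeight θ.F θ.w k.1 a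

/-- What the nodes are to output. -/
noncomputable def out (v : Fin n) : StepOutput n β A where
  compSketches i k := θ.leaderSketch S (i, k) v
  notified := {e | ∃ c, e = s(v, c) ∧ (θ.SampledFrom S v c ∨ θ.SampledFrom S c v)}

end Definitions

section Correctness

variable {S : SketchScheme n β Seed A} {θ : StepInput n Seed}

theorem candidate_eq_some_iff {k : SketchIndex n β} {v a c : Fin n} :
    θ.candidate S k v = some (a, c) ↔
      S.sample θ.seed k.1 k.2 (θ.leaderSketch S k v) = some s(a, c) ∧
        θ.leader k.1 a = v ∧ θ.leader k.1 c ≠ v := by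
  refine pick_eq_some_iff fun q q' ⟨hq, _, hout⟩ ⟨hq', hin', _⟩ => ?_
  rcases Sym2.eq_iff.1 (Option.some.inj (hq.symm.trans hq')) with ⟨h₁, h₂⟩ | ⟨_, h₂⟩
  · exact Prod.ext h₁ h₂
  · exact absurd (h₂ ▸ hin') hout

theorem componentSketch_eq_leaderSketch (i : Fin (numPhases n)) (k : Fin β) (v : Fin n) :
    S.componentSketch θ.seed θ.G θ.F θ.w i k v = θ.leaderSketch S (i, k) (θ.leader i v) := by
  refine Finset.sum_congr (Finset.ext fun u => ?_) fun _ _ => rfl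
  rw [mem_phaseComp_iff_phaseLeader_eq, Finset.mem_filter_univ]
  rfl

theorem mem_sampledEdges_iff {e : Sym2 (Fin n)} :
    e ∈ S.sampledEdges θ.seed θ.G θ.F θ.w ↔ ∃ a c, e = s(a, c) ∧ θ.SampledFrom S a c := by
  constructor
  · rintro ⟨i, v, k, hsample, ⟨hG, a, ha, c, hc, rfl⟩, hw⟩
    rw [Finset.mem_coe] at ha
    rw [Finset.mem_coe, mem_phaseComp_iff_phaseLeader_eq] at hc
    rw [componentSketch_eq_leaderSketch] at hsample
    refine ⟨a, c, rfl, θ.leader i v, (i, k), candidate_eq_some_iff.2 ⟨hsample, ?_, hc⟩, hG, ?_⟩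
    · exact mem_phaseComp_iff_phaseLeader_eq.1 ha
    · rwa [phaseWeight_eq_of_mem ha]
  · rintro ⟨a, c, rfl, _, ⟨i, k⟩, hcandidate, hG, hw⟩
    obtain ⟨hsample, rfl, hc⟩ := candidate_eq_some_iff.1 hcandidate
    rw [← componentSketch_eq_leaderSketch] at hsample
    refine ⟨i, a, k, hsample, ⟨hG, a, mem_phaseComp_self _ _ _ _, c, ?_, rfl⟩, hw⟩
    rwa [Finset.mem_coe, mem_phaseComp_iff_phaseLeader_eq]

theorem stepCorrect_out : StepCorrect S θ.seed θ.G θ.F θ.w (θ.out S) := by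
  refine ⟨fun i v k => (componentSketch_eq_leaderSketch i k v).symm, fun v => Set.ext fun e => ?_⟩
  simp only [out, Set.mem_ofPred_eq, mem_sampledEdges_iff]
  constructor
  · rintro ⟨c, rfl, h | h⟩
    · exact ⟨⟨v, c, rfl, h⟩, Sym2.mem_mk_left v c⟩
    · exact ⟨⟨c, v, Sym2.eq_swap, h⟩, Sym2.mem_mk_left v c⟩
  · rintro ⟨⟨a, c, rfl, h⟩, hv⟩
    rcases Sym2.mem_iff.1 hv with rfl | rfl
    · exact ⟨c, rfl, Or.inl h⟩
    · exact ⟨a, Sym2.eq_swap, Or.inr h⟩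

end Correctness

section Protocol

variable (S : SketchScheme n β Seed A)

theorem determines_leader : Determines (fun θ : StepInput n Seed => θ.view S)
    fun θ v (i : Fin (numPhases n)) => θ.leader i v :=
  fun _ _ _ h => congrArg LocalView.label h

theorem determines_sketch : Determines (fun θ : StepInput n Seed => θ.view S)
    fun θ v k => θ.sketch S k v :=
  fun _ _ _ h => funext fun k => congrFun₂ (congrArg LocalView.sketches h) k.1 k.2

theorem determines_light : Determines (fun θ : StepInput n Seed => θ.view S)
    fun θ a c (i : Fin (numPhases n)) =>
      θ.G.Adj a c ∧ (θ.w s(a, c) : ℕ∞) ≤ phaseWeight θ.F θ.w i a := by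
  have hiff (θ : StepInput n Seed) (a c) (i : Fin (numPhases n)) :
      (θ.G.Adj a c ∧ (θ.w s(a, c) : ℕ∞) ≤ phaseWeight θ.F θ.w i a) ↔
        ∃ y, (θ.view S a).incidentG c = some y ∧ (y : ℕ∞) ≤ (θ.view S a).weight i := by
    by_cases h : θ.G.Adj a c <;> simp [view, localView, h]
  intro a θ θ' (h : θ.view S a = θ'.view S a)
  exact funext₂ fun c i => propext ((hiff θ a c i).trans (h ▸ (hiff θ' a c i).symm))

/-- What a node knows after the leaders have obtained the sketches and members of their
components. -/
noncomputable def gathered (θ : StepInput n Seed) (v : Fin n) :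
    (LocalView n β Seed A × (SketchIndex n β → A)) × (Fin n → Fin (numPhases n) → Prop) :=
  ((θ.view S v, fun k => θ.leaderSketch S k v), fun u i => θ.leader i u = v)

theorem determines_candidate : Determines (gathered S) fun θ v k => θ.candidate S k v := by
  intro v θ θ' h
  obtain ⟨⟨hview, hsketch⟩, hmember⟩ := by simpa only [gathered, Prod.mk.injEq] using h
  have hseed : θ.seed = θ'.seed := congrArg LocalView.seed hview
  have hmember (i : Fin (numPhases n)) (u : Fin n) : (θ.leader i u = v) = (θ'.leader i u = v) :=
    congrFun₂ hmember u i
  funext k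
  simp only [candidate, ne_eq, hmember, congrFun hsketch k, hseed]

theorem realizes_out_of_sampledFrom {b : ℕ} [Nonempty Seed] (hn : 1 ≤ n ^ b) :
    Realizes b 1 (Fintype.card (Fin n × SketchIndex n β))
      (fun (θ : StepInput n Seed) v => (gathered S θ v, θ.SampledFrom S v)) fun θ => θ.out S := by
  refine (realizes_notify hn (r := fun θ : StepInput n Seed => θ.SampledFrom S)
    (f := fun θ j => (θ.candidate S j.2 j.1).getD (j.1, j.1))
    (fun v θ θ' h => (Prod.mk.inj h).2) ?_).determines fun v θ θ' h => ?_
  · rintro θ a c ⟨u, k, hcandidate, -⟩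
    exact ⟨(u, k), by rw [hcandidate, Option.getD_some]⟩
  · obtain ⟨⟨hgathered, hfrom⟩, hto⟩ := by simpa only [Prod.mk.injEq] using h
    have hsketch := (Prod.mk.inj (Prod.mk.inj hgathered).1).2
    simp only [out, hfrom, congrFun hto, congrFun hsketch]

variable {b C T : ℕ} {B Z : Type} [NeZero C] [NeZero T] [Nonempty Seed] [Finite Z]
  (π : RelayPlan n C T (SketchIndex n β) B A Z)
  (hZ : (Nat.card ((Fin n × Fin C) × Z) + 1) ^ (C * C) ≤ n ^ b)
include π hZ

theorem realizes_gathered [Add B] [IsCancelAdd B] (hb : 2 ^ numPhases n ≤ n ^ b) :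
    Realizes b 7 (6 * (Fintype.card (Fin n × SketchIndex n β) * T) + n * numPhases n)
      (fun θ => θ.view S) (gathered S) := by
  have hsum := π.realizes_labelSum hZ (x := fun θ : StepInput n Seed => θ.view S)
    (label := fun θ k => θ.leader k.1) (val := fun θ => θ.sketch S)
    (fun v θ θ' h => funext fun k => congrFun (determines_leader S v h) k.1) (determines_sketch S)
  have hmembers := realizes_fibers (ι := Fin (numPhases n)) (b := b) (by simpa using hb)
    (x := fun (θ : StepInput n Seed) v => (θ.view S v, fun k => θ.leaderSketch S k v))
    (label := fun θ i => θ.leader i)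
    fun v θ θ' h => determines_leader S v (Prod.mk.inj h).1
  rw [Fintype.card_fin] at hmembers
  exact hsum.trans hmembers

theorem realizes_sampledFrom : Realizes b 2 (2 * (Fintype.card (Fin n × SketchIndex n β) * T))
    (gathered S) fun (θ : StepInput n Seed) v => (gathered S θ v, θ.SampledFrom S v) := by
  refine (π.realizes_announce hZ (determines_candidate S)
    fun θ k u u' a c c' h h' => ?_).determines fun v θ θ' h => ?_
  · rw [← (candidate_eq_some_iff.1 h).2.1, (candidate_eq_some_iff.1 h').2.1]
  · obtain ⟨hgathered, hreceived⟩ := Prod.mk.inj h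
    have hlight := determines_light S v (Prod.mk.inj (Prod.mk.inj hgathered).1).1
    refine Prod.ext hgathered (funext fun c => propext ?_)
    refine exists_congr fun u => exists_congr fun k => and_congr ?_ ?_
    · exact iff_of_eq (congrFun (congrFun₂ hreceived u k) c)
    · exact iff_of_eq (congrFun₂ hlight c k.1)

theorem realizes_out [Add B] [IsCancelAdd B] (hb : 2 ^ numPhases n ≤ n ^ b) :
    Realizes b 10 (9 * (n * (numPhases n * β) * T) + n * numPhases n)
      (fun θ : StepInput n Seed => θ.view S) fun θ => θ.out S := by
  refine (((realizes_gathered S π hZ hb).trans (realizes_sampledFrom S π hZ)).trans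
    (realizes_out_of_sampledFrom S (Nat.one_le_two_pow.trans hb))).mono ?_
  have hT : 1 ≤ T := NeZero.one_le
  simp only [Fintype.card_prod, Fintype.card_fin]
  nlinarith [Nat.le_mul_of_pos_right (n * (numPhases n * β)) hT]

end Protocol

end StepInput

theorem two_pow_numPhases_le {n : ℕ} (hn : 2 ≤ n) : 2 ^ numPhases n ≤ n ^ 3 := by
  have hclog : 2 ^ (Nat.clog 2 n - 1) < n := Nat.pow_pred_clog_lt_self one_lt_two (by lia)
  have hpos : 0 < Nat.clog 2 n := Nat.clog_pos one_lt_two hn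
  calc 2 ^ numPhases n = 2 ^ (Nat.clog 2 n - 1) * 2 ^ 2 := by
        rw [← pow_add, numPhases]
        congr 1
        lia
    _ ≤ n * n ^ 2 := Nat.mul_le_mul hclog.le (Nat.pow_le_pow_left hn 2)
    _ = n ^ 3 := by ring

section Plan

variable {n T Q E N : ℕ}

/-- The number of blocks of `T` relays in the `RelayPlan` for `Q` indices: with so many blocks, the
`Q * T` pairs of an index and a group can have different blocks, and the members of a group of
about `n / T` nodes can have different places. -/
def numBlocks (n T Q : ℕ) : ℕ := Q * T + n / T + 1

instance : NeZero (numBlocks n T Q) := ⟨Nat.succ_ne_zero _⟩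

theorem le_mul_numBlocks (hT : 0 < T) (Q : ℕ) : n ≤ T * numBlocks n T Q :=
  calc n ≤ T * (n / T + 1) := (Nat.lt_mul_div_succ n hT).le
    _ ≤ T * numBlocks n T Q := Nat.mul_le_mul_left T (by rw [numBlocks]; lia)

theorem numBlocks_mul_le (hQ : Q * T * T ≤ E * n) (hT : T ≤ E * n) :
    numBlocks n T Q * T ≤ n * (2 * E + 1) :=
  calc numBlocks n T Q * T = Q * T * T + n / T * T + T := by rw [numBlocks]; ring
    _ ≤ E * n + n + E * n := by gcongr; exact Nat.div_mul_le_self n T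
    _ = n * (2 * E + 1) := by ring

theorem card_packets_le (hn : 2 ≤ n) (hT : 0 < T) (hQ : Q * T * T ≤ E * n) (hN : N ≤ n ^ T) :
    n * Q * (n * N) ≤ n ^ ((E + 4) * T) :=
  calc n * Q * (n * N) ≤ n * (E * n) * (n * n ^ T) := by
        gcongr
        rw [mul_assoc] at hQ
        exact (Nat.le_mul_of_pos_right Q (Nat.mul_pos hT hT)).trans hQ
    _ ≤ n * (n ^ E * n) * (n * n ^ T) := by gcongr; exact (Nat.lt_pow_self hn).le
    _ = n ^ (E + 3 + T) := by ring
    _ ≤ n ^ ((E + 4) * T) := Nat.pow_le_pow_right (by lia) (by nlinarith)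

theorem RelayPlan.nonempty {ι A : Type} [Fintype ι] [Finite A] (hn : 2 ≤ n) (hT : 0 < T)
    (hA : Nat.card A ≤ n ^ T) (hQ : Fintype.card ι * T * T ≤ E * n) (hTE : T ≤ E * n) :
    Nonempty (RelayPlan n (2 * E + 1) T ι (ZMod (numBlocks n T (Fintype.card ι))) A
      (Fin (n ^ (E + 4)))) := by
  have := Fintype.ofFinite A
  rw [Nat.card_eq_fintype_card] at hA
  have hrelay := numBlocks_mul_le hQ hTE
  have hbase : Fintype.card ι * T ≤ numBlocks n T (Fintype.card ι) := by rw [numBlocks]; lia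
  have hhelper : Fintype.card ι * T ≤ n * (2 * E + 1) := by nlinarith
  have hplace := le_mul_numBlocks (n := n) hT (Fintype.card ι)
  have hencode := card_packets_le hn hT hQ hA
  rw [pow_mul] at hencode
  obtain ⟨relay⟩ : Nonempty (ZMod (numBlocks n T (Fintype.card ι)) × Fin T ↪
      Fin n × Fin (2 * E + 1)) := Function.Embedding.nonempty_of_card_le (by simpa [ZMod.card])
  obtain ⟨helper⟩ : Nonempty (ι × Fin T ↪ Fin n × Fin (2 * E + 1)) :=
    Function.Embedding.nonempty_of_card_le (by simpa)
  obtain ⟨base⟩ : Nonempty (ι × Fin T ↪ ZMod (numBlocks n T (Fintype.card ι))) :=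
    Function.Embedding.nonempty_of_card_le (by simpa [ZMod.card])
  obtain ⟨place⟩ : Nonempty (Fin n ↪ Fin T × ZMod (numBlocks n T (Fintype.card ι))) :=
    Function.Embedding.nonempty_of_card_le (by simpa [ZMod.card])
  obtain ⟨encode⟩ : Nonempty ((Fin n × ι) × (Fin n × A) ↪ (Fin T → Fin (n ^ (E + 4)))) :=
    Function.Embedding.nonempty_of_card_le (by simpa)
  exact ⟨⟨relay, helper, base, place, encode⟩⟩

theorem card_chunks_add_one_le (hn : 2 ≤ n) (C E : ℕ) :
    Nat.card ((Fin n × Fin C) × Fin (n ^ E)) + 1 ≤ n ^ (C + E + 2) := by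
  have hone : 1 ≤ n ^ (C + E + 1) := Nat.one_le_pow _ _ (by lia)
  calc Nat.card ((Fin n × Fin C) × Fin (n ^ E)) + 1 = n * C * n ^ E + 1 := by simp
    _ ≤ n * n ^ C * n ^ E + 1 := by gcongr; exact (Nat.lt_pow_self hn).le
    _ = n ^ (C + E + 1) + 1 := by ring
    _ ≤ n ^ (C + E + 1) * n := by nlinarith
    _ = n ^ (C + E + 2) := by ring

theorem StepInput.realizes_out_of_le {β : ℕ} {Seed A : Type} [AddCommGroup A] [Finite A]
    (S : SketchScheme n β Seed A) (hn : 2 ≤ n) (hT : 0 < T) (hA : Nat.card A ≤ n ^ T)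
    (hQ : numPhases n * β * T * T ≤ E * n) (hTE : T ≤ E * n) :
    Realizes ((3 * E + 7) * ((2 * E + 1) * (2 * E + 1))) 10
      (9 * (n * (numPhases n * β) * T) + n * numPhases n)
      (fun θ : StepInput n Seed => θ.view S) fun θ => θ.out S := by
  rcases isEmpty_or_nonempty Seed with hSeed | hSeed
  · have : IsEmpty (StepInput n Seed) := ⟨fun θ => hSeed.elim θ.seed⟩
    have : Nonempty (StepOutput n β A) := ⟨⟨fun _ _ => 0, ∅⟩⟩
    exact realizes_of_isEmpty ..
  have : NeZero T := ⟨hT.ne'⟩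
  obtain ⟨π⟩ := RelayPlan.nonempty (ι := SketchIndex n β) hn hT hA (by simpa using hQ) hTE
  refine realizes_out S π ?_ ((two_pow_numPhases_le hn).trans (Nat.pow_le_pow_right ?_ ?_))
  · rw [pow_mul n]
    refine Nat.pow_le_pow_left ((card_chunks_add_one_le hn _ _).trans_eq ?_) _
    congr 1
    ring
  · lia
  · nlinarith [Nat.zero_le E]

end Plan

section Parameters

variable {n β N : ℕ} {γ p K L : ℝ}

theorem one_le_two_mul_log (hn : 2 ≤ n) : 1 ≤ 2 * Real.log n := by
  have hlog : Real.log 2 ≤ Real.log n := Real.log_le_log (by norm_num) (by exact_mod_cast hn)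
  linarith [Real.log_two_gt_d9]

theorem numPhases_le_log (hn : 2 ≤ n) : (numPhases n : ℝ) ≤ 3 * (2 * Real.log n) := by
  have hclog : (Nat.clog 2 n : ℝ) < Real.logb 2 n + 1 := by
    rw [← Real.natCeil_logb_natCast 2 n]
    exact Nat.ceil_lt_add_one (Real.logb_nonneg one_lt_two (by exact_mod_cast one_le_two.trans hn))
  have hlogb : Real.logb 2 n ≤ 2 * Real.log n := by
    rw [Real.logb, div_le_iff₀ (Real.log_pos one_lt_two)]
    nlinarith [Real.log_two_gt_d9, one_le_two_mul_log hn]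
  rw [numPhases, Nat.cast_succ]
  linarith [one_le_two_mul_log hn]

theorem log_pow_div_le {x : ℝ} (hx : 1 ≤ x) (hγ : γ < 1) (hp : x ^ (-γ) ≤ p) {d : ℕ} (hd : d ≠ 0) :
    Real.log x ^ d / p ≤ (d / (1 - γ)) ^ d * x := by
  have hx₀ : 0 < x := one_pos.trans_le hx
  have hγ₁ : 0 < 1 - γ := sub_pos.2 hγ
  have hd₀ : (0 : ℝ) < d := by positivity
  have hε : 0 < (1 - γ) / d := div_pos hγ₁ hd₀
  have hlog : Real.log x ≤ d / (1 - γ) * x ^ ((1 - γ) / d) :=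
    (Real.log_le_rpow_div hx₀.le hε).trans_eq (by field_simp)
  rw [div_le_iff₀ ((Real.rpow_pos_of_pos hx₀ _).trans_le hp)]
  calc Real.log x ^ d ≤ (d / (1 - γ) * x ^ ((1 - γ) / d)) ^ d :=
        pow_le_pow_left₀ (Real.log_nonneg hx) hlog d
    _ = (d / (1 - γ)) ^ d * x ^ (1 - γ) := by
        rw [mul_pow, ← Real.rpow_mul_natCast hx₀.le, div_mul_cancel₀ _ hd₀.ne']
    _ = (d / (1 - γ)) ^ d * x * x ^ (-γ) := by
        rw [sub_eq_add_neg, Real.rpow_add hx₀, Real.rpow_one, mul_assoc]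
    _ ≤ (d / (1 - γ)) ^ d * x * p := by gcongr

theorem le_pow_of_logb_le {T : ℕ} (hn : 0 < n) (hN : 0 < N)
    (h : Real.logb 2 N ≤ T * Real.logb 2 n) : N ≤ n ^ T := by
  rw [← Real.logb_pow, Real.logb_le_logb one_lt_two (by positivity) (by positivity)] at h
  exact_mod_cast h

theorem exists_le_pow_of_logb_le (hn : 2 ≤ n) (hN : 0 < N)
    (h : Real.logb 2 N ≤ L * Real.log n ^ 4) :
    ∃ T : ℕ, 0 < T ∧ N ≤ n ^ T ∧ (T : ℝ) ≤ (|L| + 2) * (2 * Real.log n) ^ 3 := by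
  have hlog := one_le_two_mul_log hn
  refine ⟨⌈|L| * Real.log n ^ 3⌉₊ + 1, Nat.succ_pos _, le_pow_of_logb_le (by lia) hN ?_, ?_⟩
  · have hlogb : Real.log n ≤ Real.logb 2 n :=
      le_div_self (Real.log_natCast_nonneg n) (Real.log_pos one_lt_two)
        (by linarith [Real.log_two_lt_d9])
    calc Real.logb 2 N ≤ L * Real.log n ^ 4 := h
      _ ≤ |L| * Real.log n ^ 3 * Real.log n := by
        rw [mul_assoc, ← pow_succ]
        gcongr
        exact le_abs_self L
      _ ≤ (⌈|L| * Real.log n ^ 3⌉₊ + 1 : ℕ) * Real.logb 2 n := by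
        gcongr
        rw [Nat.cast_succ]
        linarith [Nat.le_ceil (|L| * Real.log n ^ 3)]
  · have hceil := Nat.ceil_lt_add_one (show 0 ≤ |L| * Real.log n ^ 3 by positivity)
    have hpow : |L| * Real.log n ^ 3 ≤ |L| * (2 * Real.log n) ^ 3 := by gcongr; linarith
    have hone : 1 ≤ (2 * Real.log n) ^ 3 := one_le_pow₀ hlog
    rw [Nat.cast_succ]
    linarith

theorem numPhases_mul_le (hn : 2 ≤ n) (hp : 0 < p) (hβ : (β : ℝ) ≤ K * (Real.log n ^ 5 / p)) :
    ((numPhases n * β : ℕ) : ℝ) ≤ 3 * |K| * ((2 * Real.log n) ^ 6 / p) := by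
  have hlog := one_le_two_mul_log hn
  have hβ' : (β : ℝ) ≤ |K| * ((2 * Real.log n) ^ 5 / p) := by
    refine hβ.trans ?_
    gcongr
    · exact le_abs_self K
    · linarith
  calc ((numPhases n * β : ℕ) : ℝ) = numPhases n * β := Nat.cast_mul _ _
    _ ≤ 3 * (2 * Real.log n) * (|K| * ((2 * Real.log n) ^ 5 / p)) := by
      gcongr
      exact numPhases_le_log hn
    _ = 3 * |K| * ((2 * Real.log n) ^ 6 / p) := by ring

theorem exists_mul_mul_le (hγ : γ < 1) {a k : ℝ} (ha : 0 ≤ a) (hk : 0 ≤ k) :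
    ∃ E : ℕ, ∀ {n : ℕ} {p : ℝ} {Q T : ℕ}, 2 ≤ n → (n : ℝ) ^ (-γ) ≤ p → p ≤ 1 →
      (T : ℝ) ≤ a * (2 * Real.log n) ^ 3 → (Q : ℝ) ≤ k * ((2 * Real.log n) ^ 6 / p) →
      Q * T * T ≤ E * n ∧ T ≤ E * n := by
  obtain ⟨E, hE⟩ := exists_nat_ge ((k * a ^ 2 + a) * (2 ^ 12 * (12 / (1 - γ)) ^ 12))
  refine ⟨E, fun {n p Q T} hn hp hp₁ hT hQ => ?_⟩
  have hn₁ : (1 : ℝ) ≤ n := by exact_mod_cast one_le_two.trans hn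
  have hp₀ : 0 < p := (Real.rpow_pos_of_pos (one_pos.trans_le hn₁) _).trans_le hp
  have hx := one_le_two_mul_log hn
  have hlog := log_pow_div_le hn₁ hγ hp (d := 12) (by norm_num)
  set x := 2 * Real.log n
  have hpow : x ^ 12 / p ≤ 2 ^ 12 * (12 / (1 - γ)) ^ 12 * n := by
    rw [mul_pow, mul_div_assoc, mul_assoc]
    gcongr
    exact_mod_cast hlog
  have hEn : (k * a ^ 2 + a) * (x ^ 12 / p) ≤ E * n :=
    calc (k * a ^ 2 + a) * (x ^ 12 / p)
        ≤ (k * a ^ 2 + a) * (2 ^ 12 * (12 / (1 - γ)) ^ 12 * n) := by gcongr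
      _ = (k * a ^ 2 + a) * (2 ^ 12 * (12 / (1 - γ)) ^ 12) * n := by ring
      _ ≤ E * n := by gcongr
  constructor <;> rify
  · calc (Q * T * T : ℝ) ≤ k * (x ^ 6 / p) * (a * x ^ 3) * (a * x ^ 3) := by gcongr
      _ = k * a ^ 2 * (x ^ 12 / p) := by ring
      _ ≤ (k * a ^ 2 + a) * (x ^ 12 / p) := by gcongr; linarith
      _ ≤ E * n := hEn
  · calc (T : ℝ) ≤ a * x ^ 3 := hT
      _ ≤ (k * a ^ 2 + a) * (x ^ 12 / p) := by
        gcongr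
        · nlinarith [mul_nonneg hk (sq_nonneg a)]
        · exact (pow_le_pow_right₀ hx (by norm_num)).trans
            (le_div_self (by positivity) hp₀ hp₁)
      _ ≤ E * n := hEn

theorem messages_le {a k : ℝ} {Q T : ℕ} (hn : 2 ≤ n) (hp : 0 < p) (hp₁ : p ≤ 1)
    (hT : (T : ℝ) ≤ a * (2 * Real.log n) ^ 3) (hQ : (Q : ℝ) ≤ k * ((2 * Real.log n) ^ 6 / p)) :
    ((9 * (n * Q * T) + n * numPhases n : ℕ) : ℝ) ≤
      2 ^ 9 * (9 * k * a + 3) * (n / p) * Real.log n ^ 9 := by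
  have hx := one_le_two_mul_log hn
  have hphases := numPhases_le_log hn
  set x := 2 * Real.log n with hxlog
  have hQT : (Q * T : ℝ) ≤ k * (x ^ 6 / p) * (a * x ^ 3) :=
    mul_le_mul hQ hT (Nat.cast_nonneg T) ((Nat.cast_nonneg Q).trans hQ)
  have hxpow : x ≤ x ^ 9 / p :=
    (le_self_pow₀ hx (by norm_num)).trans (le_div_self (by positivity) hp hp₁)
  calc ((9 * (n * Q * T) + n * numPhases n : ℕ) : ℝ) = n * (9 * (Q * T) + numPhases n) := by
        push_cast
        ring
    _ ≤ n * (9 * (k * (x ^ 6 / p) * (a * x ^ 3)) + 3 * (x ^ 9 / p)) := by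
        gcongr
        linarith
    _ = 2 ^ 9 * (9 * k * a + 3) * (n / p) * Real.log n ^ 9 := by
        rw [hxlog]
        ring

end Parameters

theorem mainTheorem9_general (γ K L : ℝ) (hγ : γ < 1) :
    ∃ (b R d : ℕ) (M : ℝ),
      ∀ (n : ℕ) (p : ℝ), 2 ≤ n → (n : ℝ) ^ (-γ) ≤ p → p ≤ 1 →
      ∀ β : ℕ, (β : ℝ) ≤ K * (Real.log n ^ 5 / p) →
      ∀ (Seed A : Type) [AddCommGroup A] [Finite A],
        Real.logb 2 (Nat.card A) ≤ L * Real.log n ^ 4 →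
      ∀ S : SketchScheme n β Seed A,
      ∃ P : CliqueProtocol n b (LocalView n β Seed A) (StepOutput n β A),
      ∀ (r : Seed) (G F : SimpleGraph (Fin n)) (w : Sym2 (Fin n) → ℕ),
        StepCorrect S r G F w (P.result (localView S r G F w) R) ∧
        (P.messageCount (localView S r G F w) R : ℝ) ≤ M * (n / p) * Real.log n ^ d := by
  obtain ⟨E, hE⟩ := exists_mul_mul_le hγ (a := |L| + 2) (k := 3 * |K|) (by positivity)
    (by positivity)
  refine ⟨(3 * E + 7) * ((2 * E + 1) * (2 * E + 1)), 10, 9,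
    2 ^ 9 * (9 * (3 * |K|) * (|L| + 2) + 3), ?_⟩
  intro n p hn hp hp₁ β hβ Seed A _ _ hA S
  have hp₀ : 0 < p := (Real.rpow_pos_of_pos (by positivity) _).trans_le hp
  obtain ⟨T, hT, hAT, hTlog⟩ := exists_le_pow_of_logb_le hn Nat.card_pos hA
  have hQlog := numPhases_mul_le hn hp₀ hβ
  obtain ⟨hQTT, hTn⟩ := hE hn hp hp₁ hTlog hQlog
  obtain ⟨P, hP⟩ := StepInput.realizes_out_of_le S hn hT hAT hQTT hTn
  refine ⟨P, fun r G F w => ?_⟩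
  obtain ⟨hresult, hcount⟩ := hP ⟨r, G, F, w⟩
  exact ⟨hresult ▸ StepInput.stepCorrect_out,
    (Nat.cast_le.2 hcount).trans (messages_le hn hp₀ hp₁ hTlog hQlog)⟩

theorem mainTheorem9 (γ K L : ℝ) (hγ : γ < 1) (c : ℕ) :
    ∃ (b R d : ℕ) (M : ℝ),
      ∀ (n : ℕ) (p : ℝ), 2 ≤ n → (n : ℝ) ^ (-γ) ≤ p → p ≤ 1 →
      ∀ β : ℕ, (β : ℝ) ≤ K * (Real.log n ^ 5 / p) →
      ∀ (Seed A : Type) [AddCommGroup A] [Finite A],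
        Real.logb 2 (Nat.card A) ≤ L * Real.log n ^ 4 →
      ∀ S : SketchScheme n β Seed A,
      ∃ P : CliqueProtocol n b (LocalView n β Seed A) (StepOutput n β A),
      ∀ (r : Seed) (G F : SimpleGraph (Fin n)) (w : Sym2 (Fin n) → ℕ),
        F ≤ G → F.IsAcyclic → Set.InjOn w G.edgeSet → (∀ e ∈ G.edgeSet, w e < n ^ c) →
          StepCorrect S r G F w (P.result (localView S r G F w) R) ∧
          (P.messageCount (localView S r G F w) R : ℝ) ≤ M * (n / p) * Real.log n ^ d := by
  obtain ⟨b, R, d, M, h⟩ := mainTheorem9_general γ K L hγ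
  exact ⟨b, R, d, M, fun n p hn hp hp₁ β hβ Seed A _ _ hA S =>
    (h n p hn hp hp₁ β hβ Seed A hA S).imp fun _ hP r G F w _ _ _ _ => hP r G F w⟩
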